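/- Let $0<\alpha\le 1$, $0<\beta\le 1$, $0<r<R$ with $4R<1$, and $P(e)=\min\{1,e\}$. Two players $i=1,2$ with priors $p=(p^1,p^2)\in[0,1]^2$ play the following two-period game. A return type $\omega\in\{R,r\}$ is fixed and unknown; a player with belief $q$ assigns probability $q$ to $\omega=R$. If aggregate effort in period $t$ is $e_t$, production is $y_t=\omega$ with probability $P(e_t)$ and $y_t=0$ otherwise, independently across periods given efforts and $\omega$. Second-period beliefs are $\pi^i=\mathbf 1(y_1=R)$ if $y_1>0$ and $\pi^i=p^i$ if $y_1=0$. A (Markov perfect) equilibrium is a profile of maps $s_t^i:[0,1]^2\to[0,\infty)$ such that, for $i=1,2$, $j\neq i$ and all $\pi,p\in[0,1]^2$, $s_2^i(\pi)$ maximizes $$\alpha\,\mathbb E_{\pi^i}[\omega]\,P\big(e+s_2^j(\pi)\big)-\tfrac12e^2$$ over $e\ge0$, and $s_1^i(p)$ maximizes $$\alpha\,\mathbb E_{p^i}[\omega]\,P\big(e+s_1^j(p)\big)-\tfrac12e^2+\beta\,\mathbb E_{p^i}\big[V^i(\pi)\,\big|\,e+s_1^j(p)\big]$$ over $e\ge0$,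 where $V^i(\pi)=\alpha\mathbb E_{\pi^i}[\omega]P\big(s_2^1(\pi)+s_2^2(\pi)\big)-\tfrac12 s_2^i(\pi)^2$ and the conditioning is on first-period aggregate effort. For $p^\star\in[0,1]$ the performance of team $p$ is $$\mathcal Y_{p^\star}(p)=\mathbb E_{p^\star}\Big[\omega\sum_{i=1}^2\big(s_1^i(p)+\beta s_2^i(\pi)\big)\Big],$$ the expectation being over $\omega$ (with prior $p^\star$) and $y_1$. Let $F$ be a probability distribution on $\mathbb R$ with support $[0,1]$ and continuous cumulative distribution function, also denoted $F$, and let $\Gamma(F,F)$ be the set of probability measures on $\mathbb R^2$ with both marginals $F$. Then $F:[0,1]\to[0,1]$ is a bijection, and $T_F(p)=F^{-1}(1-F(p))$ is a strictly decreasing map from $[0,1]$ to itself. Moreover, the game has an equilibrium, and for every equilibrium $s$ and every $p^\star\in[0,1]$, with $\mathcal Y_{p^\star}$ evaluated at $s$, the function $\mathcal Y_{p^\star}$ is $\gamma$-integrable on $[0,1]^2$ for each $\gamma\in\Gamma(F,F)$ and the manager's problem $$\max_{\gamma\in\Gamma(F,F)}\ \frac12\int_{[0,1]^2}\mathcal Y_{p^\star}(p,p')\,d\gamma(p,p')$$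 has a unique solution. This solution is negative assortative: it is the law of $(p,T_F(p))$ with $p\sim F$, and its support is exactly the graph $\{(p,T_F(p)):p\in[0,1]\}$, so that for each $p\in[0,1]$ the teammate of an employee of type $p$ has type $T_F(p)=F^{-1}(1-F(p))$. -/

import Mathlib

open Set MeasureTheory ProbabilityTheory

noncomputable section

/-- Primitives of the two-period production game: each player's share `α` of the output, the
discount factor `β`, and the high and low returns `R`, `r` of the technology. -/
structure ProductionGame where
  α : ℝ
  β : ℝ
  R : ℝ
  r : ℝ

/-- A strategy profile for `N` players: `first i p` (`second i π`) is the effort of player `i` in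
period one (two) when the belief profile at the beginning of the period is `p` (`π`). Only the
values at belief profiles in `[0,1]^N` matter. -/
structure StrategyProfile (N : ℕ) where
  first : Fin N → (Fin N → ℝ) → ℝ
  second : Fin N → (Fin N → ℝ) → ℝ

/-- Belief profiles: the cube `[0,1]^N`. -/
def beliefCube (N : ℕ) : Set (Fin N → ℝ) := {p | ∀ i, p i ∈ Icc (0 : ℝ) 1}

/-- Probability of a return at aggregate effort `e`. -/
def successProb (e : ℝ) : ℝ := min 1 e

/-- Cost of effort. -/
def effortCost (e : ℝ) : ℝ := e ^ 2 / 2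

namespace ProductionGame

variable (G : ProductionGame) {N : ℕ}

/-- Expectation of `f ω`, where the return type `ω` equals `R` with probability `q` and `r` with
probability `1 - q`. -/
def expReturn (q : ℝ) (f : ℝ → ℝ) : ℝ := q * f G.R + (1 - q) * f G.r

/-- Expectation of `f ω y`, where `ω` equals `R` with probability `q` and `r` otherwise, and, given
`ω`, first-period production `y` equals `ω` with probability `successProb e` and `0` otherwise. -/
def expOutcome (q e : ℝ) (f : ℝ → ℝ → ℝ) : ℝ :=
  G.expReturn q fun ω => successProb e * f ω ω + (1 - successProb e) * f ω 0

/-- Beliefs at the beginning of period two after first-period production `y`: a return reveals its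
type to every player; without a return the priors `p` are kept. -/
def posterior (p : Fin N → ℝ) (y : ℝ) : Fin N → ℝ :=
  if 0 < y then fun _ => if y = G.R then 1 else 0 else p

/-- Expected second-period payoff of player `i` at beliefs `π` when she exerts effort `e` and the
others play according to `s`. -/
def payoff₂ (s : StrategyProfile N) (i : Fin N) (π : Fin N → ℝ) (e : ℝ) : ℝ :=
  G.α * G.expReturn (π i) (fun ω => ω)
      * successProb (e + ∑ j ∈ Finset.univ.erase i, s.second j π)
    - effortCost e

/-- Second-period value of player `i` at beliefs `π` when everybody plays according to `s`. -/
def value₂ (s : StrategyProfile N) (i : Fin N) (π : Fin N → ℝ) : ℝ :=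
  G.α * G.expReturn (π i) (fun ω => ω) * successProb (∑ j, s.second j π)
    - effortCost (s.second i π)

/-- Present value, for player `i` at priors `p`, of exerting first-period effort `e` when the others
play according to `s` in period one and everybody does so in period two. -/
def payoff₁ (s : StrategyProfile N) (i : Fin N) (p : Fin N → ℝ) (e : ℝ) : ℝ :=
  G.α * G.expReturn (p i) (fun ω => ω)
      * successProb (e + ∑ j ∈ Finset.univ.erase i, s.first j p)
    - effortCost e
    + G.β * G.expOutcome (p i) (e + ∑ j ∈ Finset.univ.erase i, s.first j p)
        (fun _ y => G.value₂ s i (G.posterior p y))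

/-- (Pure-strategy) Markov perfect equilibrium: in each period, at each belief profile, the
nonnegative effort of each player maximizes her payoff over all nonnegative efforts. -/
structure IsEquilibrium (s : StrategyProfile N) : Prop where
  second_nonneg : ∀ i, ∀ π ∈ beliefCube N, 0 ≤ s.second i π
  second_opt : ∀ i, ∀ π ∈ beliefCube N, ∀ e, 0 ≤ e →
    G.payoff₂ s i π e ≤ G.payoff₂ s i π (s.second i π)
  first_nonneg : ∀ i, ∀ p ∈ beliefCube N, 0 ≤ s.first i p
  first_opt : ∀ i, ∀ p ∈ beliefCube N, ∀ e, 0 ≤ e →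
    G.payoff₁ s i p e ≤ G.payoff₁ s i p (s.first i p)

/-- Team performance: expected aggregate (discounted) output
`E_{p⋆}[ω ∑ᵢ (s₁ⁱ(p) + β s₂ⁱ(π))]` of a team with priors `p` playing `s`, evaluated at the
manager's prior `pStar`; here `π` is the random posterior profile. -/
def teamOutput (s : StrategyProfile N) (pStar : ℝ) (p : Fin N → ℝ) : ℝ :=
  G.expOutcome pStar (∑ i, s.first i p)
    (fun ω y => ω * ∑ i, (s.first i p + G.β * s.second i (G.posterior p y)))

/-- Total expected output `½ ∫_{[0,1]²} Y_{p⋆}(p, p') dγ(p, p')` of a workforce matched into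
two-member teams according to `γ`. -/
def totalOutput (s : StrategyProfile 2) (pStar : ℝ) (γ : Measure (ℝ × ℝ)) : ℝ :=
  1 / 2 * ∫ x in Icc (0 : ℝ) 1 ×ˢ Icc (0 : ℝ) 1, G.teamOutput s pStar ![x.1, x.2] ∂γ

end ProductionGame

/-- Joint probability measures with first marginal `μ` and second marginal `ν`. -/
def couplings (μ ν : Measure ℝ) : Set (Measure (ℝ × ℝ)) :=
  {γ | IsProbabilityMeasure γ ∧ γ.fst = μ ∧ γ.snd = ν}

/-- `γ` solves the manager's problem of maximizing total expected output over all couplings with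
both marginals equal to the distribution `μ` of priors in the workforce. -/
def SolvesManagerProblem (G : ProductionGame) (s : StrategyProfile 2) (pStar : ℝ)
    (μ : Measure ℝ) (γ : Measure (ℝ × ℝ)) : Prop :=
  γ ∈ couplings μ μ ∧ ∀ γ' ∈ couplings μ μ, G.totalOutput s pStar γ' ≤ G.totalOutput s pStar γ

/-- The inverse `F⁻¹` of the cumulative distribution function of `μ`, as a map on `[0,1]`. -/
def cdfInv (μ : Measure ℝ) : ℝ → ℝ := Function.invFunOn (cdf μ) (Icc (0 : ℝ) 1)

/-- The negative assortative plan `T_F(p) = F⁻¹(1 - F(p))`. -/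
def negAssortPlan (μ : Measure ℝ) (p : ℝ) : ℝ := cdfInv μ (1 - cdf μ p)

end

/-! Since `4R < 1` and `α, β ≤ 1`, the cap in `successProb` never binds in equilibrium. Each period
is then a contribution game in which every player's effort equals her own marginal benefit of
success (`contribution_nash_iff`). Backward induction gives unique efforts on the belief cube
(`isEquilibrium_iff`), and team output becomes an explicit polynomial (`teamOutput_eq`).

Write `K` for total first-period effort, `S` for the sum of the shares, `m` for the manager's mean
return and `c = 2αβ E[ω²]`. Output is `K (m + c - β m S) + β m S`. Optimistic teammates are
substitutes: raising one prior lowers the marginal effect of the other on `K`, and success forgoes a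
larger `S`. Hence the partial derivative in one prior strictly decreases in the other
(`outputPolyDeriv_strictAntiOn`).

The rest is optimal transport with a strictly submodular surplus. The first-order condition along
the graph of `T_F` determines potentials `φ`, `ψ` with `w ≤ φ + ψ`, and equality exactly on that
graph (`exists_dual_potentials`). The integral of `φ + ψ` depends only on the marginals, so the
optimal couplings are exactly those concentrated on the graph, and there is only one
(`transport_optimal`). -/

theorem successProb_of_le {e : ℝ} (h : e ≤ 1) : successProb e = e := min_eq_right h

theorem Fin.sum_univ_erase_two (f : Fin 2 → ℝ) (i : Fin 2) :
    ∑ j ∈ Finset.univ.erase i, f j = f i.rev := by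
  rw [show Finset.univ.erase i = {i.rev} by revert i; decide, Finset.sum_singleton]

/-- In the two-player contribution game with marginal benefits `A i`, whose total is at most one,
the unique Nash equilibrium consists of the efforts `A i`. -/
theorem contribution_nash_iff {A σ : Fin 2 → ℝ} (hA : ∀ i, 0 ≤ A i) (hA1 : A 0 + A 1 ≤ 1) :
    (∀ i, 0 ≤ σ i ∧ ∀ e, 0 ≤ e → A i * successProb (e + σ i.rev) - effortCost e
      ≤ A i * successProb (σ i + σ i.rev) - effortCost (σ i)) ↔ ∀ i, σ i = A i := by
  have hsum : ∀ i, A i + A i.rev ≤ 1 := by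
    intro i; fin_cases i
    · simpa using hA1
    · simpa [add_comm] using hA1
  constructor
  · intro h
    -- As `successProb` is 1-Lipschitz, cutting an excessive effort back to `A i` loses at most `A i
    -- * (σ i - A i)` in benefit and saves strictly more in cost.
    have hle : ∀ i, σ i ≤ A i := by
      intro i
      by_contra! hlt
      have h1 := (h i).2 (A i) (hA i)
      have h2 : successProb (σ i + σ i.rev) ≤ successProb (A i + σ i.rev) + (σ i - A i) := by
        unfold successProb
        rcases le_total 1 (A i + σ i.rev) with h3 | h3
        · rw [min_eq_left h3]; linarith [min_le_left 1 (σ i + σ i.rev)]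
        · rw [min_eq_right h3]; linarith [min_le_right 1 (σ i + σ i.rev)]
      have h3 := mul_le_mul_of_nonneg_left h2 (hA i)
      unfold effortCost at h1
      nlinarith [mul_pos (sub_pos.2 hlt) (sub_pos.2 hlt)]
    intro i
    have h1 := (h i).2 (A i) (hA i)
    -- Overprovision being excluded, both aggregates lie where `successProb` is the identity;
    -- deviating to `A i` then gains exactly `(σ i - A i) ^ 2 / 2`.
    have h2 : A i + σ i.rev ≤ 1 := by linarith [hle i.rev, hsum i]
    have h3 : σ i + σ i.rev ≤ 1 := by linarith [hle i]
    rw [successProb_of_le h2, successProb_of_le h3] at h1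
    unfold effortCost at h1
    have h4 : (σ i - A i) ^ 2 ≤ 0 := by nlinarith
    nlinarith [pow_eq_zero_iff (two_ne_zero) |>.1 (le_antisymm h4 (sq_nonneg _))]
  · intro h i
    rw [h i, h i.rev]
    refine ⟨hA i, fun e _ => ?_⟩
    rw [successProb_of_le (hsum i)]
    have h2 := mul_le_mul_of_nonneg_left (min_le_right 1 (e + A i.rev)) (hA i)
    unfold successProb effortCost
    nlinarith [sq_nonneg (e - A i)]

namespace ProductionGame

variable (G : ProductionGame)

/-- The parameter restrictions of the two-player game. -/
structure Admissible : Prop where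
  α_pos : 0 < G.α
  α_le : G.α ≤ 1
  β_pos : 0 < G.β
  β_le : G.β ≤ 1
  r_pos : 0 < G.r
  r_lt : G.r < G.R
  R_lt : 4 * G.R < 1

/-- The expected return `E_q[ω]`. -/
noncomputable def meanReturn (q : ℝ) : ℝ := G.expReturn q fun ω => ω

/-- A player's expected share `α E_q[ω]` of the return. -/
noncomputable def share (q : ℝ) : ℝ := G.α * G.meanReturn q

/-- The equilibrium continuation value of a player with belief `x` and a teammate with belief `y`. -/
noncomputable def contValue (x y : ℝ) : ℝ := G.share x ^ 2 / 2 + G.share x * G.share y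

/-- The marginal benefit of the probability of a first-period return to a player with prior `x`
and a teammate with prior `y`. -/
noncomputable def incentive (x y : ℝ) : ℝ :=
  G.share x + G.β * (x * G.contValue 1 1 + (1 - x) * G.contValue 0 0 - G.contValue x y)

/-- Aggregate first-period equilibrium effort. -/
noncomputable def totalIncentive (x y : ℝ) : ℝ := G.incentive x y + G.incentive y x

/-- Equilibrium team output as a polynomial in the two priors. -/
noncomputable def outputPoly (pStar x y : ℝ) : ℝ :=
  G.totalIncentive x y * (G.meanReturn pStar
      + 2 * G.α * G.β * G.expReturn pStar (fun ω => ω ^ 2)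
      - G.β * G.meanReturn pStar * (G.share x + G.share y))
    + G.β * G.meanReturn pStar * (G.share x + G.share y)

variable {G}

/-! ### Bounds on shares, continuation values and incentives -/

theorem meanReturn_eq (q : ℝ) : G.meanReturn q = q * G.R + (1 - q) * G.r := rfl

theorem share_sub (x y : ℝ) : G.share x - G.share y = G.α * (G.R - G.r) * (x - y) := by
  unfold share meanReturn expReturn; ring

theorem share_one : G.share 1 = G.α * G.R := by simp [share, meanReturn, expReturn]

theorem share_zero : G.share 0 = G.α * G.r := by simp [share, meanReturn, expReturn]

theorem const_mem_beliefCube {c : ℝ} (hc : c ∈ Icc (0 : ℝ) 1) :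
    (fun _ => c : Fin 2 → ℝ) ∈ beliefCube 2 := fun _ => hc

namespace Admissible

variable (hG : G.Admissible) {x y : ℝ}
include hG

theorem meanReturn_pos (hx : x ∈ Icc (0 : ℝ) 1) : 0 < G.meanReturn x := by
  have := hG.r_pos; have := hG.r_lt
  rw [meanReturn_eq]; nlinarith [hx.1, hx.2]

theorem meanReturn_lt (hx : x ∈ Icc (0 : ℝ) 1) : G.meanReturn x < 1 / 4 := by
  have := hG.R_lt; have := hG.r_lt
  rw [meanReturn_eq]; nlinarith [hx.1, hx.2]

theorem share_pos (hx : x ∈ Icc (0 : ℝ) 1) : 0 < G.share x :=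
  mul_pos hG.α_pos (hG.meanReturn_pos hx)

theorem share_lt (hx : x ∈ Icc (0 : ℝ) 1) : G.share x < 1 / 4 := by
  have := mul_le_mul_of_nonneg_right hG.α_le (hG.meanReturn_pos hx).le
  have := hG.meanReturn_lt hx
  unfold share; linarith

theorem contValue_pos (hx : x ∈ Icc (0 : ℝ) 1) (hy : y ∈ Icc (0 : ℝ) 1) :
    0 < G.contValue x y := by
  have := hG.share_pos hx; have := hG.share_pos hy
  unfold contValue; positivity

/-- The constant is `1/8 + 1/4`, both shares being below `1/4`. It makes the continuation value
forgone by a success smaller than the current share, which keeps incentives positive. -/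
theorem contValue_le (hx : x ∈ Icc (0 : ℝ) 1) (hy : y ∈ Icc (0 : ℝ) 1) :
    G.contValue x y ≤ 3 / 8 * G.share x := by
  have := hG.share_pos hx; have := hG.share_lt hy; have := hG.share_lt hx
  unfold contValue; nlinarith

theorem incentive_pos (hx : x ∈ Icc (0 : ℝ) 1) (hy : y ∈ Icc (0 : ℝ) 1) :
    0 < G.incentive x y := by
  have h0 : (0 : ℝ) ∈ Icc (0 : ℝ) 1 := by simp
  have h1 : (1 : ℝ) ∈ Icc (0 : ℝ) 1 := by simp
  have a := hG.contValue_le hx hy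
  have b := mul_nonneg hx.1 (hG.contValue_pos h1 h1).le
  have c := mul_nonneg (sub_nonneg.2 hx.2) (hG.contValue_pos h0 h0).le
  have d := mul_le_mul_of_nonneg_right hG.β_le (hG.contValue_pos hx hy).le
  have e := mul_nonneg hG.β_pos.le (add_nonneg b c)
  have := hG.share_pos hx
  unfold incentive; nlinarith

/-- The share is below `1/4`, and each continuation value after a revealed type is at most `3/8 *
1/4 = 3/32`. Two efforts thus sum to less than one. -/
theorem incentive_lt (hx : x ∈ Icc (0 : ℝ) 1) (hy : y ∈ Icc (0 : ℝ) 1) :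
    G.incentive x y < 1 / 2 := by
  have h0 : (0 : ℝ) ∈ Icc (0 : ℝ) 1 := by simp
  have h1 : (1 : ℝ) ∈ Icc (0 : ℝ) 1 := by simp
  have a := hG.contValue_le h1 h1
  have a' := hG.contValue_le h0 h0
  have b := mul_le_mul_of_nonneg_left (a.trans (by linarith [hG.share_lt h1] :
    _ ≤ (3 / 32 : ℝ))) hx.1
  have c := mul_le_mul_of_nonneg_left (a'.trans (by linarith [hG.share_lt h0] :
    _ ≤ (3 / 32 : ℝ))) (sub_nonneg.2 hx.2)
  have d := mul_pos hG.β_pos (hG.contValue_pos hx hy)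
  have e := mul_le_mul_of_nonneg_left (add_le_add b c) hG.β_pos.le
  have := hG.share_lt hx
  have := hG.β_le
  unfold incentive; nlinarith

end Admissible

/-! ### Equilibrium efforts -/

theorem posterior_R (hG : G.Admissible) (p : Fin 2 → ℝ) : G.posterior p G.R = fun _ => 1 := by
  simp [posterior, hG.r_pos.trans hG.r_lt]

theorem posterior_r (hG : G.Admissible) (p : Fin 2 → ℝ) : G.posterior p G.r = fun _ => 0 := by
  simp [posterior, hG.r_pos, hG.r_lt.ne]

theorem posterior_zero (p : Fin 2 → ℝ) : G.posterior p 0 = p := by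
  simp [posterior]

theorem payoff₂_eq (s : StrategyProfile 2) (i : Fin 2) (π : Fin 2 → ℝ) (e : ℝ) :
    G.payoff₂ s i π e
      = G.share (π i) * successProb (e + s.second i.rev π) - effortCost e := by
  rw [payoff₂, Fin.sum_univ_erase_two (fun j => s.second j π)]; rfl

theorem sum_fin_two_rev (f : Fin 2 → ℝ) (i : Fin 2) : ∑ j, f j = f i + f i.rev := by
  rw [← Fin.sum_univ_erase_two f i, Finset.add_sum_erase _ _ (Finset.mem_univ i)]

theorem second_nash_iff (hG : G.Admissible) (s : StrategyProfile 2) {π : Fin 2 → ℝ}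
    (hπ : π ∈ beliefCube 2) :
    (∀ i, 0 ≤ s.second i π ∧ ∀ e, 0 ≤ e → G.payoff₂ s i π e ≤ G.payoff₂ s i π (s.second i π))
      ↔ ∀ i, s.second i π = G.share (π i) := by
  simp only [payoff₂_eq]
  exact contribution_nash_iff (A := fun i => G.share (π i)) (σ := fun i => s.second i π)
    (fun i => (hG.share_pos (hπ i)).le)
    (by linarith [hG.share_lt (hπ 0), hG.share_lt (hπ 1)])

section SecondPeriod

variable (hG : G.Admissible) {s : StrategyProfile 2}
  (hs : ∀ π ∈ beliefCube 2, ∀ i, s.second i π = G.share (π i))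
include hG hs

theorem value₂_eq {π : Fin 2 → ℝ} (hπ : π ∈ beliefCube 2) (i : Fin 2) :
    G.value₂ s i π = G.contValue (π i) (π i.rev) := by
  have h : G.share (π i) + G.share (π i.rev) ≤ 1 := by
    linarith [hG.share_lt (hπ i), hG.share_lt (hπ i.rev)]
  rw [value₂, sum_fin_two_rev _ i, hs π hπ, hs π hπ, successProb_of_le h]
  unfold contValue effortCost
  change G.share (π i) * _ - _ = _
  ring

/-- The continuation payoff is affine in the success probability, because failure leaves the priors
unchanged. The first period is therefore again a contribution game, up to a constant. -/
theorem payoff₁_eq {p : Fin 2 → ℝ} (hp : p ∈ beliefCube 2) (i : Fin 2) (e : ℝ) :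
    G.payoff₁ s i p e
      = G.incentive (p i) (p i.rev) * successProb (e + s.first i.rev p) - effortCost e
        + G.β * G.contValue (p i) (p i.rev) := by
  have h0 : (0 : ℝ) ∈ Icc (0 : ℝ) 1 := by simp
  have h1 : (1 : ℝ) ∈ Icc (0 : ℝ) 1 := by simp
  rw [payoff₁, Fin.sum_univ_erase_two (fun j => s.first j p)]
  simp only [expOutcome]
  rw [expReturn, expReturn, posterior_R hG, posterior_r hG, posterior_zero,
    value₂_eq hG hs (const_mem_beliefCube h1), value₂_eq hG hs (const_mem_beliefCube h0),
    value₂_eq hG hs hp]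
  unfold incentive share meanReturn expReturn
  ring

theorem first_nash_iff {p : Fin 2 → ℝ} (hp : p ∈ beliefCube 2) :
    (∀ i, 0 ≤ s.first i p ∧ ∀ e, 0 ≤ e → G.payoff₁ s i p e ≤ G.payoff₁ s i p (s.first i p))
      ↔ ∀ i, s.first i p = G.incentive (p i) (p i.rev) := by
  simp only [payoff₁_eq hG hs hp, add_le_add_iff_right]
  exact contribution_nash_iff (A := fun i => G.incentive (p i) (p i.rev))
    (σ := fun i => s.first i p) (fun i => (hG.incentive_pos (hp i) (hp i.rev)).le)
    (by linarith [hG.incentive_lt (hp 0) (hp (Fin.rev 0)),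
      hG.incentive_lt (hp 1) (hp (Fin.rev 1))])

end SecondPeriod

theorem isEquilibrium_iff (hG : G.Admissible) (s : StrategyProfile 2) :
    G.IsEquilibrium s ↔
      (∀ π ∈ beliefCube 2, ∀ i, s.second i π = G.share (π i)) ∧
      ∀ p ∈ beliefCube 2, ∀ i, s.first i p = G.incentive (p i) (p i.rev) := by
  constructor
  · intro h
    have hs : ∀ π ∈ beliefCube 2, ∀ i, s.second i π = G.share (π i) := fun π hπ =>
      (second_nash_iff hG s hπ).1 fun i => ⟨h.second_nonneg i π hπ, h.second_opt i π hπ⟩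
    exact ⟨hs, fun p hp => (first_nash_iff hG hs hp).1 fun i =>
      ⟨h.first_nonneg i p hp, h.first_opt i p hp⟩⟩
  · rintro ⟨hs, hf⟩
    exact
      { second_nonneg := fun i π hπ => ((second_nash_iff hG s hπ).2 (hs π hπ) i).1
        second_opt := fun i π hπ => ((second_nash_iff hG s hπ).2 (hs π hπ) i).2
        first_nonneg := fun i p hp => ((first_nash_iff hG hs hp).2 (hf p hp) i).1
        first_opt := fun i p hp => ((first_nash_iff hG hs hp).2 (hf p hp) i).2 }

theorem exists_isEquilibrium (hG : G.Admissible) : ∃ s : StrategyProfile 2, G.IsEquilibrium s :=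
  ⟨⟨fun i p => G.incentive (p i) (p i.rev), fun i π => G.share (π i)⟩,
    (isEquilibrium_iff hG _).2 ⟨fun _ _ _ => rfl, fun _ _ _ => rfl⟩⟩

theorem teamOutput_eq (hG : G.Admissible) {s : StrategyProfile 2} (hs : G.IsEquilibrium s)
    (pStar : ℝ) {x y : ℝ} (hx : x ∈ Icc (0 : ℝ) 1) (hy : y ∈ Icc (0 : ℝ) 1) :
    G.teamOutput s pStar ![x, y] = G.outputPoly pStar x y := by
  have h0 : (0 : ℝ) ∈ Icc (0 : ℝ) 1 := by simp
  have h1 : (1 : ℝ) ∈ Icc (0 : ℝ) 1 := by simp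
  obtain ⟨h₂, h₁⟩ := (isEquilibrium_iff hG s).1 hs
  have hp : (![x, y] : Fin 2 → ℝ) ∈ beliefCube 2 := by
    intro i; fin_cases i
    · exact hx
    · exact hy
  have hP : G.incentive x y + G.incentive y x ≤ 1 := by
    linarith [hG.incentive_lt hx hy, hG.incentive_lt hy hx]
  have e0 : s.first 0 ![x, y] = G.incentive x y := h₁ _ hp 0
  have e1 : s.first 1 ![x, y] = G.incentive y x := h₁ _ hp 1
  have f0 : s.second 0 ![x, y] = G.share x := h₂ _ hp 0
  have f1 : s.second 1 ![x, y] = G.share y := h₂ _ hp 1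
  simp only [teamOutput, expOutcome, Fin.sum_univ_two]
  rw [expReturn, posterior_R hG, posterior_r hG, posterior_zero,
    h₂ _ (const_mem_beliefCube h1), h₂ _ (const_mem_beliefCube h1),
    h₂ _ (const_mem_beliefCube h0), h₂ _ (const_mem_beliefCube h0), e0, e1, f0, f1,
    successProb_of_le hP, share_one, share_zero]
  unfold outputPoly totalIncentive meanReturn expReturn
  ring

/-! ### Strict submodularity of equilibrium team output -/

variable (G) in
/-- The partial derivative of `totalIncentive` in the first prior. -/
noncomputable def totalIncentiveDeriv (x y : ℝ) : ℝ :=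
  G.α * (G.R - G.r) + G.β * (G.contValue 1 1 - G.contValue 0 0
    - G.α * (G.R - G.r) * (G.share x + 2 * G.share y))

variable (G) in
/-- The partial derivative of `outputPoly` in the first prior. -/
noncomputable def outputPolyDeriv (pStar x y : ℝ) : ℝ :=
  G.totalIncentiveDeriv x y * (G.meanReturn pStar
      + 2 * G.α * G.β * G.expReturn pStar (fun ω => ω ^ 2)
      - G.β * G.meanReturn pStar * (G.share x + G.share y))
    - G.β * G.meanReturn pStar * (G.α * (G.R - G.r)) * G.totalIncentive x y
    + G.β * G.meanReturn pStar * (G.α * (G.R - G.r))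

theorem hasDerivAt_share (x : ℝ) : HasDerivAt G.share (G.α * (G.R - G.r)) x := by
  have h : G.share = fun x => G.α * (G.R - G.r) * x + G.share 0 := by
    funext x; linarith [share_sub (G := G) x 0]
  rw [h]
  simpa using ((hasDerivAt_id x).const_mul (G.α * (G.R - G.r))).add_const (G.share 0)

theorem hasDerivAt_totalIncentive (x y : ℝ) :
    HasDerivAt (fun x => G.totalIncentive x y) (G.totalIncentiveDeriv x y) x := by
  have h := hasDerivAt_share (G := G) x
  have hi := hasDerivAt_id' x
  have h1 := h.add ((((hi.mul_const (G.contValue 1 1)).add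
    ((hi.const_sub 1).mul_const (G.contValue 0 0))).sub
    (((h.pow 2).div_const 2).add (h.mul_const (G.share y)))).const_mul G.β)
  -- `h1` differentiates the player's own incentive, `h2` the teammate's.
  have h2 := (((h.const_mul (G.share y)).const_add (G.share y ^ 2 / 2)).const_sub
    (y * G.contValue 1 1 + (1 - y) * G.contValue 0 0)).const_mul G.β |>.const_add (G.share y)
  exact (h1.add h2).congr_deriv (by simp only [totalIncentiveDeriv]; push_cast; ring)

theorem hasDerivAt_outputPoly (pStar x y : ℝ) :
    HasDerivAt (fun x => G.outputPoly pStar x y) (G.outputPolyDeriv pStar x y) x := by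
  have h := ((hasDerivAt_share (G := G) x).add_const (G.share y)).const_mul
    (G.β * G.meanReturn pStar)
  have hk := hasDerivAt_totalIncentive (G := G) x y
  exact ((hk.mul (h.const_sub (G.meanReturn pStar
      + 2 * G.α * G.β * G.expReturn pStar (fun ω => ω ^ 2)))).add h).congr_deriv
    (by unfold outputPolyDeriv; ring)

theorem totalIncentive_comm (x y : ℝ) : G.totalIncentive x y = G.totalIncentive y x :=
  add_comm _ _

/-- The negative part is `β * (share x + 2 * share y)` times the slope of the share; this factor is
below `3/4`, so the direct effect of the share dominates. -/
theorem totalIncentiveDeriv_pos (hG : G.Admissible) {x y : ℝ} (hx : x ∈ Icc (0 : ℝ) 1)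
    (hy : y ∈ Icc (0 : ℝ) 1) : 0 < G.totalIncentiveDeriv x y := by
  have h0 : (0 : ℝ) ∈ Icc (0 : ℝ) 1 := by simp
  have hΔ : 0 < G.α * (G.R - G.r) := mul_pos hG.α_pos (sub_pos.2 hG.r_lt)
  have hs : G.share 0 < G.share 1 := by linarith [share_sub (G := G) 1 0]
  have hV : 0 ≤ G.contValue 1 1 - G.contValue 0 0 := by
    unfold contValue; nlinarith [hG.share_pos h0]
  have a := mul_nonneg hG.β_pos.le hV
  have hsum : 0 < G.share x + 2 * G.share y := by
    linarith [hG.share_pos hx, hG.share_pos hy]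
  have hb : G.β * (G.share x + 2 * G.share y) < 1 :=
    lt_of_le_of_lt (mul_le_of_le_one_left hsum.le hG.β_le)
      (by linarith [hG.share_lt hx, hG.share_lt hy])
  have c := mul_pos hΔ (sub_pos.2 hb)
  unfold totalIncentiveDeriv; nlinarith

theorem totalIncentive_strictMonoOn (hG : G.Admissible) {y : ℝ} (hy : y ∈ Icc (0 : ℝ) 1) :
    StrictMonoOn (fun x => G.totalIncentive x y) (Icc 0 1) :=
  strictMonoOn_of_deriv_pos (convex_Icc 0 1)
    (fun x _ => (hasDerivAt_totalIncentive x y).continuousAt.continuousWithinAt) fun x hx => by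
      rw [(hasDerivAt_totalIncentive x y).deriv]
      exact totalIncentiveDeriv_pos hG (interior_subset hx) hy

/-- As `y` grows, `totalIncentiveDeriv` and the factor multiplying it are positive and strictly
decrease, while `totalIncentive` strictly increases and enters with a negative sign. -/
theorem outputPolyDeriv_strictAntiOn (hG : G.Admissible) {pStar : ℝ}
    (hpStar : pStar ∈ Icc (0 : ℝ) 1) {x : ℝ} (hx : x ∈ Icc (0 : ℝ) 1) :
    StrictAntiOn (G.outputPolyDeriv pStar x) (Icc 0 1) := by
  intro y hy y' hy' hlt
  have hΔ : 0 < G.α * (G.R - G.r) := mul_pos hG.α_pos (sub_pos.2 hG.r_lt)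
  have hm := hG.meanReturn_pos hpStar
  have hβm := mul_pos hG.β_pos hm
  have hs : G.share y < G.share y' := by
    nlinarith [share_sub (G := G) y' y, mul_pos hΔ (sub_pos.2 hlt)]
  have hk : G.totalIncentive x y < G.totalIncentive x y' := by
    rw [totalIncentive_comm x, totalIncentive_comm x]
    exact totalIncentive_strictMonoOn hG hx hy hy' hlt
  have hd : G.totalIncentiveDeriv x y' < G.totalIncentiveDeriv x y := by
    have := mul_pos (mul_pos hG.β_pos hΔ) (sub_pos.2 hs)
    unfold totalIncentiveDeriv; nlinarith
  have hd0 := totalIncentiveDeriv_pos hG hx hy'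
  have hsq : 0 ≤ 2 * G.α * G.β * G.expReturn pStar (fun ω => ω ^ 2) := by
    have := hG.α_pos; have := hG.β_pos; have := hpStar.1; have := sub_nonneg.2 hpStar.2
    unfold expReturn; positivity
  have hM : 0 < G.meanReturn pStar + 2 * G.α * G.β * G.expReturn pStar (fun ω => ω ^ 2)
      - G.β * G.meanReturn pStar * (G.share x + G.share y') := by
    have h1 := mul_le_mul_of_nonneg_right hG.β_le hm.le
    have h2 : G.share x + G.share y' < 1 := by linarith [hG.share_lt hx, hG.share_lt hy']
    nlinarith [mul_pos hβm (sub_pos.2 h2)]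
  have hML := mul_lt_mul_of_pos_left hs hβm
  have hMlt : G.meanReturn pStar + 2 * G.α * G.β * G.expReturn pStar (fun ω => ω ^ 2)
      - G.β * G.meanReturn pStar * (G.share x + G.share y')
      < G.meanReturn pStar + 2 * G.α * G.β * G.expReturn pStar (fun ω => ω ^ 2)
      - G.β * G.meanReturn pStar * (G.share x + G.share y) := by linarith
  have hA := mul_lt_mul'' hd hMlt hd0.le hM.le
  have hB := mul_lt_mul_of_pos_left hk (mul_pos hβm hΔ)
  unfold outputPolyDeriv
  linarith

theorem continuous_share : Continuous G.share := by
  unfold share meanReturn expReturn; fun_prop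

theorem continuous_outputPoly (pStar : ℝ) :
    Continuous fun z : ℝ × ℝ => G.outputPoly pStar z.1 z.2 := by
  have := continuous_share (G := G)
  unfold outputPoly totalIncentive incentive contValue; fun_prop

theorem continuous_outputPolyDeriv (pStar : ℝ) :
    Continuous fun z : ℝ × ℝ => G.outputPolyDeriv pStar z.1 z.2 := by
  have := continuous_share (G := G)
  unfold outputPolyDeriv totalIncentiveDeriv totalIncentive incentive contValue; fun_prop

end ProductionGame

/-! ### Distributions with continuous distribution function and support `[0,1]` -/

section NegativeAssortment

variable {μ : Measure ℝ}

theorem ae_mem_Icc_of_support (hsupp : μ.support = Icc (0 : ℝ) 1) :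
    ∀ᵐ x ∂μ, x ∈ Icc (0 : ℝ) 1 := by
  rw [← hsupp]; exact Measure.support_mem_ae

theorem one_sub_cdf_mem (x : ℝ) : 1 - cdf μ x ∈ Icc (0 : ℝ) 1 :=
  ⟨sub_nonneg.2 (cdf_le_one μ x), sub_le_self _ (cdf_nonneg μ x)⟩

theorem ae_mem_square_of_coupling (hsupp : μ.support = Icc (0 : ℝ) 1) {γ : Measure (ℝ × ℝ)}
    (hγ : γ ∈ couplings μ μ) : ∀ᵐ z ∂γ, z ∈ Icc (0 : ℝ) 1 ×ˢ Icc (0 : ℝ) 1 := by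
  obtain ⟨_, h1, h2⟩ := hγ
  have h := ae_mem_Icc_of_support hsupp
  have h1' := ae_of_ae_map (μ := γ) measurable_fst.aemeasurable (h1.symm ▸ h)
  have h2' := ae_of_ae_map (μ := γ) measurable_snd.aemeasurable (h2.symm ▸ h)
  filter_upwards [h1', h2'] with z hz hz' using ⟨hz, hz'⟩

variable [IsProbabilityMeasure μ]

theorem measure_singleton_of_continuous_cdf (hcont : Continuous (cdf μ)) (x : ℝ) :
    μ {x} = 0 := by
  rw [← measure_cdf μ, StieltjesFunction.measure_singleton,
    hcont.continuousAt.continuousWithinAt.leftLim_eq, sub_self, ENNReal.ofReal_zero]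

/-- Every open subinterval of the support has positive mass. -/
theorem cdf_strictMonoOn (hsupp : μ.support = Icc (0 : ℝ) 1) :
    StrictMonoOn (cdf μ) (Icc 0 1) := by
  intro x hx y hy hxy
  have hm : (x + y) / 2 ∈ μ.support := by
    rw [hsupp]; constructor <;> linarith [hx.1, hx.2, hy.1, hy.2]
  have h1 : 0 < μ (Ioo x y) := (Measure.mem_support_iff_forall _).1 hm _
    (Ioo_mem_nhds (by linarith) (by linarith))
  have h2 := h1.trans_le (measure_mono Ioo_subset_Ioc_self)
  rw [← measure_cdf μ, StieltjesFunction.measure_Ioc, ENNReal.ofReal_pos] at h2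
  linarith

theorem cdf_of_one_le (hsupp : μ.support = Icc (0 : ℝ) 1) {x : ℝ} (hx : 1 ≤ x) :
    cdf μ x = 1 := by
  have h : μ (Iic x) = 1 := by
    rw [← mem_ae_iff_prob_eq_one measurableSet_Iic]
    filter_upwards [ae_mem_Icc_of_support hsupp] with y hy using hy.2.trans hx
  rw [cdf_eq_real, measureReal_def, h, ENNReal.toReal_one]

variable (hcont : Continuous (cdf μ)) (hsupp : μ.support = Icc (0 : ℝ) 1)
include hcont hsupp

theorem cdf_of_nonpos {x : ℝ} (hx : x ≤ 0) : cdf μ x = 0 := by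
  have h : μ (Iic x) = 0 := by
    -- At `x = 0` the support alone would allow an atom; continuity of the distribution function
    -- rules it out.
    have h0 : ∀ᵐ y ∂μ, y ≠ 0 := by
      rw [ae_iff]; simpa using measure_singleton_of_continuous_cdf hcont 0
    have h2 : ∀ᵐ y ∂μ, ¬ y ≤ x := by
      filter_upwards [h0, ae_mem_Icc_of_support hsupp] with y hy hy' hyx
      exact hy (le_antisymm (hyx.trans hx) hy'.1)
    rw [ae_iff] at h2
    simpa [Iic] using h2
  rw [cdf_eq_real, measureReal_def, h, ENNReal.toReal_zero]

theorem cdf_bijOn : BijOn (cdf μ) (Icc 0 1) (Icc 0 1) := by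
  refine ⟨fun x _ => ⟨cdf_nonneg μ x, cdf_le_one μ x⟩, (cdf_strictMonoOn hsupp).injOn, ?_⟩
  have h := intermediate_value_Icc (zero_le_one (α := ℝ)) hcont.continuousOn
  rwa [cdf_of_nonpos hcont hsupp le_rfl, cdf_of_one_le hsupp le_rfl] at h

theorem negAssortPlan_mem (x : ℝ) : negAssortPlan μ x ∈ Icc (0 : ℝ) 1 :=
  Function.invFunOn_mem ((cdf_bijOn hcont hsupp).surjOn (one_sub_cdf_mem x))

theorem cdf_negAssortPlan (x : ℝ) : cdf μ (negAssortPlan μ x) = 1 - cdf μ x :=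
  Function.invFunOn_eq ((cdf_bijOn hcont hsupp).surjOn (one_sub_cdf_mem x))

theorem negAssortPlan_strictAntiOn : StrictAntiOn (negAssortPlan μ) (Icc 0 1) := by
  intro x hx y hy hxy
  rw [← (cdf_strictMonoOn hsupp).lt_iff_lt (negAssortPlan_mem hcont hsupp y)
    (negAssortPlan_mem hcont hsupp x), cdf_negAssortPlan hcont hsupp,
    cdf_negAssortPlan hcont hsupp]
  linarith [cdf_strictMonoOn hsupp hx hy hxy]

theorem negAssortPlan_negAssortPlan {x : ℝ} (hx : x ∈ Icc (0 : ℝ) 1) :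
    negAssortPlan μ (negAssortPlan μ x) = x :=
  (cdf_strictMonoOn hsupp).injOn (negAssortPlan_mem hcont hsupp _) hx (by
    rw [cdf_negAssortPlan hcont hsupp, cdf_negAssortPlan hcont hsupp, sub_sub_cancel])

/-- On `[0,1]` the distribution function is an order isomorphism, so its inverse is continuous.
Composing with `1 - cdf μ` gives continuity on all of `ℝ`. -/
theorem continuous_negAssortPlan : Continuous (negAssortPlan μ) := by
  have hb := cdf_bijOn hcont hsupp
  have hmono : StrictMono (hb.mapsTo.restrict (cdf μ) (Icc 0 1) (Icc 0 1)) :=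
    fun x y hxy => cdf_strictMonoOn hsupp x.2 y.2 hxy
  let e := StrictMono.orderIsoOfSurjective _ hmono (by
    rintro ⟨y, hy⟩
    obtain ⟨x, hx, rfl⟩ := hb.surjOn hy
    exact ⟨⟨x, hx⟩, rfl⟩)
  have h : negAssortPlan μ = fun x => (e.symm ⟨1 - cdf μ x, one_sub_cdf_mem x⟩ : ℝ) := by
    funext x
    have h1 : e ⟨negAssortPlan μ x, negAssortPlan_mem hcont hsupp x⟩
        = ⟨1 - cdf μ x, one_sub_cdf_mem x⟩ := Subtype.ext (cdf_negAssortPlan hcont hsupp x)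
    rw [← h1, e.symm_apply_apply]
  rw [h]
  exact continuous_subtype_val.comp (e.symm.continuous.comp
    ((continuous_const.sub hcont).subtype_mk _))

theorem map_negAssortPlan : μ.map (negAssortPlan μ) = μ := by
  have hT := (continuous_negAssortPlan hcont hsupp).measurable
  have : IsProbabilityMeasure (μ.map (negAssortPlan μ)) :=
    Measure.isProbabilityMeasure_map hT.aemeasurable
  refine Measure.eq_of_cdf _ _ (StieltjesFunction.ext fun t => ?_)
  have hmem := negAssortPlan_mem hcont hsupp
  rw [cdf_eq_real, map_measureReal_apply hT measurableSet_Iic]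
  rcases lt_or_ge t 0 with h0 | h0
  · rw [cdf_of_nonpos hcont hsupp h0.le, show negAssortPlan μ ⁻¹' Iic t = ∅ from
      eq_empty_of_forall_notMem fun x hx => (h0.trans_le (hmem x).1).not_ge hx,
      measureReal_empty]
  rcases lt_or_ge 1 t with h1 | h1
  · rw [cdf_of_one_le hsupp h1.le, show negAssortPlan μ ⁻¹' Iic t = univ from
      eq_univ_of_forall fun x => (hmem x).2.trans h1.le, probReal_univ]
  have ht : t ∈ Icc (0 : ℝ) 1 := ⟨h0, h1⟩
  have hne : ∀ᵐ x ∂μ, x ≠ negAssortPlan μ t := by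
    rw [ae_iff]; simpa using measure_singleton_of_continuous_cdf hcont _
  -- The plan is a decreasing involution, so its sublevel set at `t` is an upper ray from
  -- `negAssortPlan μ t`; the endpoint is null.
  have hset : negAssortPlan μ ⁻¹' Iic t =ᵐ[μ] ((Iic (negAssortPlan μ t))ᶜ : Set ℝ) := by
    filter_upwards [hne, ae_mem_Icc_of_support hsupp] with x hx hx'
    have h := (negAssortPlan_strictAntiOn hcont hsupp).le_iff_ge hx' (hmem t)
    rw [negAssortPlan_negAssortPlan hcont hsupp ht] at h
    refine propext (show negAssortPlan μ x ≤ t ↔ ¬ x ≤ negAssortPlan μ t from ?_)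
    rw [not_le]
    exact h.trans ⟨fun h => lt_of_le_of_ne h hx.symm, le_of_lt⟩
  have hcongr : μ.real (negAssortPlan μ ⁻¹' Iic t) = μ.real ((Iic (negAssortPlan μ t))ᶜ : Set ℝ) :=
    measureReal_congr hset
  rw [hcongr, probReal_compl_eq_one_sub measurableSet_Iic, ← cdf_eq_real,
    cdf_negAssortPlan hcont hsupp, sub_sub_cancel]

theorem negAssort_mem_couplings :
    μ.map (fun p => (p, negAssortPlan μ p)) ∈ couplings μ μ := by
  have hT := (continuous_negAssortPlan hcont hsupp).measurable
  have hg : Measurable fun p => (p, negAssortPlan μ p) := measurable_id.prodMk hT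
  refine ⟨Measure.isProbabilityMeasure_map hg.aemeasurable, ?_, ?_⟩
  · rw [Measure.fst, Measure.map_map measurable_fst hg]; exact Measure.map_id
  · rw [Measure.snd, Measure.map_map measurable_snd hg]; exact map_negAssortPlan hcont hsupp

theorem support_negAssort :
    (μ.map (fun p => (p, negAssortPlan μ p))).support
      = (fun p => (p, negAssortPlan μ p)) '' Icc (0 : ℝ) 1 := by
  have hg : Continuous fun p => (p, negAssortPlan μ p) :=
    continuous_id.prodMk (continuous_negAssortPlan hcont hsupp)
  refine Subset.antisymm ?_ ?_
  · refine Measure.support_subset_of_isClosed (isCompact_Icc.image hg).isClosed ?_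
    have hms := (isCompact_Icc (a := (0 : ℝ)) (b := 1) |>.image hg).isClosed.measurableSet
    refine (ae_map_iff hg.aemeasurable hms).2 ?_
    filter_upwards [ae_mem_Icc_of_support hsupp] with x hx using mem_image_of_mem _ hx
  · rintro _ ⟨p, hp, rfl⟩
    rw [Measure.mem_support_iff_forall]
    intro U hU
    rw [← hsupp] at hp
    exact ((Measure.mem_support_iff_forall p).1 hp _ (hg.continuousAt hU)).trans_le
      (Measure.le_map_apply hg.aemeasurable U)

/-! ### Optimal transport of a strictly submodular surplus -/

/-- Dual potentials certifying the optimality of the negative assortative plan. -/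
theorem exists_dual_potentials {w D : ℝ → ℝ → ℝ} (hw : Continuous fun z : ℝ × ℝ => w z.1 z.2)
    (hD : Continuous fun z : ℝ × ℝ => D z.1 z.2)
    (hwD : ∀ x y, HasDerivAt (fun x => w x y) (D x y) x)
    (hanti : ∀ x ∈ Icc (0 : ℝ) 1, StrictAntiOn (D x) (Icc 0 1)) :
    ∃ φ ψ : ℝ → ℝ, Continuous φ ∧ Continuous ψ ∧
      ∀ x ∈ Icc (0 : ℝ) 1, ∀ y ∈ Icc (0 : ℝ) 1, w x y ≤ φ x + ψ y ∧
        (w x y = φ x + ψ y ↔ y = negAssortPlan μ x) := by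
  set T := negAssortPlan μ with hTdef
  have hT : Continuous T := continuous_negAssortPlan hcont hsupp
  have hmem : ∀ x, T x ∈ Icc (0 : ℝ) 1 := negAssortPlan_mem hcont hsupp
  have hTT : ∀ x ∈ Icc (0 : ℝ) 1, T (T x) = x := fun x hx =>
    negAssortPlan_negAssortPlan hcont hsupp hx
  have hTa : StrictAntiOn T (Icc 0 1) := negAssortPlan_strictAntiOn hcont hsupp
  have hc : Continuous fun x => D x (T x) := hD.comp (continuous_id.prodMk hT)
  -- If `w - φ - ψ` is maximal along the graph of `T`, its `x`-derivative vanishes there, which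
  -- forces `φ' x = D x (T x)`.
  let φ : ℝ → ℝ := fun x => ∫ s in (0 : ℝ)..x, D s (T s)
  have hφ : ∀ x, HasDerivAt φ (D x (T x)) x := fun x =>
    intervalIntegral.integral_hasDerivAt_right (hc.intervalIntegrable _ _)
      (hc.stronglyMeasurableAtFilter _ _) hc.continuousAt
  have hφc : Continuous φ := continuous_iff_continuousAt.2 fun x => (hφ x).continuousAt
  have hd : ∀ y x, HasDerivAt (fun x => w x y - φ x) (D x y - D x (T x)) x :=
    fun y x => (hwD x y).sub (hφ x)
  -- For fixed `y`, the function `w x y - φ x` has derivative `D x y - D x (T x)`, positive left of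
  -- `T y` and negative right of it. Its strict maximum at `T y` serves as `ψ y`.
  have key : ∀ x ∈ Icc (0 : ℝ) 1, ∀ y ∈ Icc (0 : ℝ) 1, x ≠ T y →
      w x y - φ x < w (T y) y - φ (T y) := by
    intro x hx y hy hne
    rcases lt_or_gt_of_ne hne with hlt | hlt
    · have hmono : StrictMonoOn (fun x => w x y - φ x) (Icc x (T y)) :=
        strictMonoOn_of_deriv_pos (convex_Icc _ _)
          (fun z _ => (hd y z).continuousAt.continuousWithinAt) fun z hz => by
            rw [interior_Icc] at hz
            have hz' : z ∈ Icc (0 : ℝ) 1 := ⟨hx.1.trans hz.1.le, hz.2.le.trans (hmem y).2⟩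
            have h1 : y < T z := by
              have := hTa hz' (hmem y) hz.2
              rwa [hTT y hy] at this
            rw [(hd y z).deriv, sub_pos]
            exact hanti z hz' hy (hmem z) h1
      exact hmono (left_mem_Icc.2 hlt.le) (right_mem_Icc.2 hlt.le) hlt
    · have hmono : StrictAntiOn (fun x => w x y - φ x) (Icc (T y) x) :=
        strictAntiOn_of_deriv_neg (convex_Icc _ _)
          (fun z _ => (hd y z).continuousAt.continuousWithinAt) fun z hz => by
            rw [interior_Icc] at hz
            have hz' : z ∈ Icc (0 : ℝ) 1 := ⟨(hmem y).1.trans hz.1.le, hz.2.le.trans hx.2⟩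
            have h1 : T z < y := by
              have := hTa (hmem y) hz' hz.1
              rwa [hTT y hy] at this
            rw [(hd y z).deriv, sub_neg]
            exact hanti z hz' (hmem z) hy h1
      exact hmono (left_mem_Icc.2 hlt.le) (right_mem_Icc.2 hlt.le) hlt
  refine ⟨φ, fun y => w (T y) y - φ (T y), hφc,
    (hw.comp (hT.prodMk continuous_id)).sub (hφc.comp hT), fun x hx y hy => ?_⟩
  by_cases hxy : x = T y
  · have hyx : y = T x := by rw [hxy, hTT y hy]
    have : w x y = φ x + (w (T y) y - φ (T y)) := by rw [← hxy]; ring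
    exact ⟨this.le, fun _ => hyx, fun _ => this⟩
  · have := key x hx y hy hxy
    refine ⟨by linarith, fun h => by linarith, fun h => absurd ?_ hxy⟩
    rw [h, hTT x hx]

/-- The negative assortative plan is the unique maximizer of a surplus with strictly
decreasing partial derivative. -/
theorem transport_optimal {w D : ℝ → ℝ → ℝ} (hw : Continuous fun z : ℝ × ℝ => w z.1 z.2)
    (hD : Continuous fun z : ℝ × ℝ => D z.1 z.2)
    (hwD : ∀ x y, HasDerivAt (fun x => w x y) (D x y) x)
    (hanti : ∀ x ∈ Icc (0 : ℝ) 1, StrictAntiOn (D x) (Icc 0 1)) :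
    ∃ C : ℝ, ∀ γ ∈ couplings μ μ,
      ∫ z in Icc (0 : ℝ) 1 ×ˢ Icc (0 : ℝ) 1, w z.1 z.2 ∂γ ≤ C ∧
      (∫ z in Icc (0 : ℝ) 1 ×ˢ Icc (0 : ℝ) 1, w z.1 z.2 ∂γ = C
        ↔ γ = μ.map fun p => (p, negAssortPlan μ p)) := by
  obtain ⟨φ, ψ, hφ, hψ, hdual⟩ := exists_dual_potentials hcont hsupp hw hD hwD hanti
  have hT := (continuous_negAssortPlan hcont hsupp).measurable
  have hg : Measurable fun p => (p, negAssortPlan μ p) := measurable_id.prodMk hT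
  refine ⟨∫ x, φ x ∂μ + ∫ y, ψ y ∂μ, fun γ hγ => ?_⟩
  have hae := ae_mem_square_of_coupling hsupp hγ
  obtain ⟨hprob, h1, h2⟩ := hγ
  rw [Measure.restrict_eq_self_of_ae_mem hae]
  have hint : ∀ f : ℝ × ℝ → ℝ, Continuous f → Integrable f γ := fun f hf => by
    rw [← Measure.restrict_eq_self_of_ae_mem hae]
    exact hf.continuousOn.integrableOn_compact (isCompact_Icc.prod isCompact_Icc)
  have e1 : ∫ x, φ x ∂μ = ∫ z, φ z.1 ∂γ := by
    rw [← h1, Measure.fst, integral_map measurable_fst.aemeasurable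
      hφ.aestronglyMeasurable]
  have e2 : ∫ x, ψ x ∂μ = ∫ z, ψ z.2 ∂γ := by
    rw [← h2, Measure.snd, integral_map measurable_snd.aemeasurable
      hψ.aestronglyMeasurable]
  have i1 := hint (fun z => φ z.1) (hφ.comp continuous_fst)
  have i2 := hint (fun z => ψ z.2) (hψ.comp continuous_snd)
  have i3 := hint _ hw
  have hgap : ∫ x, φ x ∂μ + ∫ y, ψ y ∂μ - ∫ z, w z.1 z.2 ∂γ
      = ∫ z, (φ z.1 + ψ z.2 - w z.1 z.2) ∂γ := by
    rw [e1, e2, ← integral_add i1 i2]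
    exact (integral_sub (i1.add i2) i3).symm
  have hnn : 0 ≤ᵐ[γ] fun z => φ z.1 + ψ z.2 - w z.1 z.2 := by
    filter_upwards [hae] with z hz
    exact sub_nonneg.2 (hdual z.1 hz.1 z.2 hz.2).1
  -- The duality gap is the integral of a nonnegative function, so it closes only if that function
  -- vanishes almost everywhere.
  have hiff : ∫ z, w z.1 z.2 ∂γ = ∫ x, φ x ∂μ + ∫ y, ψ y ∂μ
      ↔ ∀ᵐ z ∂γ, z.2 = negAssortPlan μ z.1 := by
    rw [eq_comm, ← sub_eq_zero, hgap,
      integral_eq_zero_iff_of_nonneg_ae hnn ((i1.add i2).sub i3)]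
    refine Filter.eventually_congr ?_
    filter_upwards [hae] with z hz
    rw [← (hdual z.1 hz.1 z.2 hz.2).2, Pi.zero_apply, sub_eq_zero, eq_comm]
  refine ⟨sub_nonneg.1 (hgap ▸ integral_nonneg_of_ae hnn), hiff.trans ⟨fun h => ?_, ?_⟩⟩
  -- A measure concentrated on a graph is the image of its first marginal.
  · calc γ = γ.map id := Measure.map_id.symm
      _ = γ.map ((fun p => (p, negAssortPlan μ p)) ∘ Prod.fst) := by
        refine Measure.map_congr ?_
        filter_upwards [h] with z hz
        exact Prod.ext rfl hz
      _ = μ.map fun p => (p, negAssortPlan μ p) := by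
        rw [← Measure.map_map hg measurable_fst]
        exact congrArg (Measure.map _) h1
  · rintro rfl
    refine (ae_map_iff hg.aemeasurable (measurableSet_eq_fun measurable_snd
      (hT.comp measurable_fst))).2 ?_
    exact Filter.Eventually.of_forall fun _ => rfl

end NegativeAssortment
-- The manager's problem at equilibrium
theorem proposition3 (G : ProductionGame)
    (hα0 : 0 < G.α) (hα1 : G.α ≤ 1) (hβ0 : 0 < G.β) (hβ1 : G.β ≤ 1)
    (hr : 0 < G.r) (hrR : G.r < G.R) (hbound : 2 * 2 * G.R < 1)
    (pStar : ℝ) (hpStar : pStar ∈ Set.Icc (0 : ℝ) 1)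
    (μ : MeasureTheory.Measure ℝ) [MeasureTheory.IsProbabilityMeasure μ]
    (hcont : Continuous (ProbabilityTheory.cdf μ))
    (hsupp : μ.support = Set.Icc (0 : ℝ) 1) :
    -- the cumulative distribution function is invertible on the unit interval, and the plan
    -- obtained from its inverse is a strictly decreasing self-map of the unit interval
    Set.BijOn (ProbabilityTheory.cdf μ) (Set.Icc (0 : ℝ) 1) (Set.Icc (0 : ℝ) 1) ∧
    Set.MapsTo (negAssortPlan μ) (Set.Icc (0 : ℝ) 1) (Set.Icc (0 : ℝ) 1) ∧
    StrictAntiOn (negAssortPlan μ) (Set.Icc (0 : ℝ) 1) ∧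
    -- the two-player game has an equilibrium, and at every equilibrium:
    (∃ s : StrategyProfile 2, G.IsEquilibrium s) ∧
    ∀ s : StrategyProfile 2, G.IsEquilibrium s →
      -- the manager's objective is well defined
      (∀ γ ∈ couplings μ μ, MeasureTheory.IntegrableOn
        (fun x : ℝ × ℝ => G.teamOutput s pStar ![x.1, x.2])
        (Set.Icc (0 : ℝ) 1 ×ˢ Set.Icc (0 : ℝ) 1) γ) ∧
      -- the manager's problem has exactly one solution
      (∃! γ : MeasureTheory.Measure (ℝ × ℝ), SolvesManagerProblem G s pStar μ γ) ∧
      -- the solution matches every type `p` with the type `negAssortPlan μ p`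
      ∀ γ : MeasureTheory.Measure (ℝ × ℝ), SolvesManagerProblem G s pStar μ γ →
        γ = μ.map (fun p => (p, negAssortPlan μ p)) ∧
        γ.support = (fun p => (p, negAssortPlan μ p)) '' Set.Icc (0 : ℝ) 1 := by
  have hG : G.Admissible := ⟨hα0, hα1, hβ0, hβ1, hr, hrR, by linarith⟩
  refine ⟨cdf_bijOn hcont hsupp, fun p _ => negAssortPlan_mem hcont hsupp p,
    negAssortPlan_strictAntiOn hcont hsupp, ProductionGame.exists_isEquilibrium hG,
    fun s hs => ?_⟩
  have hms : MeasurableSet (Icc (0 : ℝ) 1 ×ˢ Icc (0 : ℝ) 1) :=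
    measurableSet_Icc.prod measurableSet_Icc
  have heq : EqOn (fun x : ℝ × ℝ => G.teamOutput s pStar ![x.1, x.2])
      (fun x => G.outputPoly pStar x.1 x.2) (Icc (0 : ℝ) 1 ×ˢ Icc (0 : ℝ) 1) :=
    fun x hx => ProductionGame.teamOutput_eq hG hs pStar hx.1 hx.2
  have htot : ∀ γ, G.totalOutput s pStar γ
      = 1 / 2 * ∫ x in Icc (0 : ℝ) 1 ×ˢ Icc (0 : ℝ) 1, G.outputPoly pStar x.1 x.2 ∂γ :=
    fun γ => by rw [ProductionGame.totalOutput, setIntegral_congr_fun hms heq]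
  obtain ⟨C, hC⟩ := transport_optimal hcont hsupp
    (ProductionGame.continuous_outputPoly (G := G) pStar)
    (ProductionGame.continuous_outputPolyDeriv pStar)
    (ProductionGame.hasDerivAt_outputPoly pStar)
    (fun x hx => ProductionGame.outputPolyDeriv_strictAntiOn hG hpStar hx)
  have hmem := negAssort_mem_couplings hcont hsupp
  have hopt := ((hC _ hmem).2).2 rfl
  have hsolves : SolvesManagerProblem G s pStar μ (μ.map fun p => (p, negAssortPlan μ p)) :=
    ⟨hmem, fun γ' hγ' => by rw [htot, htot, hopt]; linarith [(hC γ' hγ').1]⟩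
  have huniq : ∀ γ, SolvesManagerProblem G s pStar μ γ →
      γ = μ.map fun p => (p, negAssortPlan μ p) := fun γ hγ => by
    have h := hγ.2 _ hmem
    rw [htot, htot, hopt] at h
    exact (hC γ hγ.1).2.1 (le_antisymm (hC γ hγ.1).1 (by linarith))
  refine ⟨fun γ hγ => ?_, ⟨_, hsolves, huniq⟩, fun γ hγ => ⟨huniq γ hγ, ?_⟩⟩
  · have := hγ.1
    exact ((ProductionGame.continuous_outputPoly pStar).continuousOn.integrableOn_compact
      (isCompact_Icc.prod isCompact_Icc)).congr_fun heq.symm hms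
  · rw [huniq γ hγ]; exact support_negAssort hcont hsupp
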